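/- **Setting.** Let $T>0$, let $F:\mathbb R\times\mathbb R\to\mathbb R$, $(x,t)\mapsto F(x,t)$, be of class $C^3$, and let $\mathbf x$ be a solution on $[0,T]$ of $$\frac{d\mathbf x}{dt}(t)=F(\mathbf x(t),t),\qquad \mathbf x(0)=x_0$$ (it is then the only one). Write $\|f\|_\infty=\sup_{[0,T]}|f|$ and $\|f\|_{L^2[0,T]}=(\int_0^T|f|^2)^{1/2}$. For knots $\tau=(0=t_1<\dots<t_k=T)$, $k\ge2$, put $$|\tau|=\max_{2\le i\le k}(t_i-t_{i-1}),\qquad \kappa=\frac{|\tau|}{\min_{2\le i\le k}(t_i-t_{i-1})},$$ let $\mathbb L_\tau$ be the space of cubic splines with knots $\tau$ (the $C^2$ functions on $[0,T]$ that agree with a polynomial of degree at most $3$ on each $[t_{i-1},t_i]$), and let $$J(\hat{\mathbf x})=\int_0^T\Big|\frac{d\hat{\mathbf x}}{dt}(t)-F(\hat{\mathbf x}(t),t)\Big|^2dt\qquad(\hat{\mathbf x}\in\mathbb L_\tau).$$ For $\delta_2>0$ and constants $\beta_1,\dots,\beta_6>0$, say that the *error bound* holds if for all knots $\tau$ of $[0,T]$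 with $|\tau|\le1$ and every $$\hat{\mathbf x}_0\in\operatorname*{arg\,min}\{J(\hat{\mathbf x}) : \hat{\mathbf x}\in\mathbb L_\tau,\ \hat{\mathbf x}(0)=x_0,\ \|\hat{\mathbf x}-\mathbf x\|_\infty<\delta_2\}$$ one has $$\|\mathbf x-\hat{\mathbf x}_0\|_\infty<\beta_1\kappa\Big\|\frac{d^2\hat{\mathbf x}_0}{dt^2}\Big\|_{L^2[0,T]}|\tau|^{1/2}+\beta_2\kappa|\tau|+\kappa\big(4\sqrt{6\kappa}+\beta_3\big)\beta_4\sqrt T\,|\tau|^{3/2}+\beta_5\sqrt T\,|\tau|^3+\beta_6\sqrt T\,|\tau|^{7/2}.$$ **Theorem 4.1.** 1. If $F_x(\mathbf x(t),t)<0$ for all $0\le t\le T$, then there are $\delta_2>0$ and $\beta_1,\dots,\beta_6>0$, depending only on $\mathbf x$ and $F$ (not on $\tau$ or $\hat{\mathbf x}_0$), for which the error bound holds. 2. The constants depend on $\mathbf x$ and $F$ only through bounds for their derivatives, and not otherwise on $T$: for all $M,\gamma,\delta_2>0$ there are $\beta_1,\dots,\beta_6>0$ such that the error bound holds, with this $\delta_2$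 and these $\beta_i$, for all $T$, $x_0$, $F$, $\mathbf x$ as in the setting with $$|\mathbf x'|,\ |\mathbf x''|,\ |\mathbf x''''|\le M\ \text{ on }[0,T],$$ $$|F(y,t)|,\ |F_x(y,t)|,\ |F_t(y,t)|\le M\ \text{ and }\ F_x(y,t)\le-\gamma\quad\text{whenever } 0\le t\le T,\ |y-\mathbf x(t)|\le\delta_2 .$$ -/

import Mathlib

open Set

namespace SplineODE

noncomputable section

/-- The uniform norm over `[0, T]` of a (continuous) function. -/
def supNorm (T : ℝ) (f : ℝ → ℝ) : ℝ :=
  ⨆ t : Icc (0 : ℝ) T, |f t|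

/-- The `L²` norm over `[0, T]` of a (continuous) function. -/
def l2Norm (T : ℝ) (f : ℝ → ℝ) : ℝ :=
  Real.sqrt (∫ t in (0 : ℝ)..T, f t ^ 2)

/-- A finite sequence of knots `0 = t₀ < t₁ < ⋯ < tₙ₊₁ = T`, cutting `[0, T]` into
`n + 1 ≥ 1` intervals. -/
structure Knots (T : ℝ) where
  n : ℕ
  t : Fin (n + 2) → ℝ
  strictMono : StrictMono t
  first : t 0 = 0
  last : t (Fin.last (n + 1)) = T

/-- The length of the `i`-th knot interval. -/
def Knots.gap {T : ℝ} (τ : Knots T) (i : Fin (τ.n + 1)) : ℝ :=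
  τ.t i.succ - τ.t i.castSucc

/-- The mesh size `|τ|`: the length of the longest knot interval. -/
def Knots.mesh {T : ℝ} (τ : Knots T) : ℝ := ⨆ i, τ.gap i

/-- The mesh ratio `κ`: the longest knot interval over the shortest one. -/
def Knots.ratio {T : ℝ} (τ : Knots T) : ℝ := τ.mesh / ⨅ i, τ.gap i

/-- The cubic splines on `[0, T]` with simple knots `τ`: functions that are `C²` on `[0, T]` and
agree with a polynomial of degree at most `3` on every knot interval.  Values outside `[0, T]` are
irrelevant everywhere below. -/
def cubicSplines {T : ℝ} (τ : Knots T) : Set (ℝ → ℝ) :=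
  {s | ContDiffOn ℝ 2 s (Icc 0 T) ∧
    ∀ i : Fin (τ.n + 1), ∃ p : Polynomial ℝ, p.natDegree ≤ 3 ∧
      ∀ u ∈ Icc (τ.t i.castSucc) (τ.t i.succ), s u = p.eval u}

/-- `x` solves `x' = F(x, t)`, `x(0) = x₀` on `[0, T]` (one-sided derivatives at the end points). -/
def IsSolution (F : ℝ → ℝ → ℝ) (T x₀ : ℝ) (x : ℝ → ℝ) : Prop :=
  x 0 = x₀ ∧ ∀ t ∈ Icc 0 T, HasDerivWithinAt x (F (x t) t) (Icc 0 T) t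

/-- The `L²`-penalty `J(s) = ∫₀ᵀ |s'(t) - F(s(t), t)|² dt`. -/
def penalty (F : ℝ → ℝ → ℝ) (T : ℝ) (s : ℝ → ℝ) : ℝ :=
  ∫ t in (0 : ℝ)..T, |derivWithin s (Icc 0 T) t - F (s t) t| ^ 2

/-- The cubic splines with initial value `x₀` at uniform distance less than `δ` from `x`. -/
def admissible {T : ℝ} (τ : Knots T) (x₀ : ℝ) (x : ℝ → ℝ) (δ : ℝ) : Set (ℝ → ℝ) :=
  {s | s ∈ cubicSplines τ ∧ s 0 = x₀ ∧ supNorm T (fun t => s t - x t) < δ}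

/-- The set `arg min` of the minimizers of the penalty among the admissible splines. -/
def minimizers (F : ℝ → ℝ → ℝ) {T : ℝ} (τ : Knots T) (x₀ : ℝ) (x : ℝ → ℝ) (δ : ℝ) :
    Set (ℝ → ℝ) :=
  {s | s ∈ admissible τ x₀ x δ ∧ ∀ w ∈ admissible τ x₀ x δ, penalty F T s ≤ penalty F T w}

/-- The right-hand side of the error bound, as a function of the constants `β₁, …, β₆`, the mesh
ratio `κ`, the mesh size `h`, the length `T` of the time interval and the `L²` norm `D` of the
second derivative of the spline. -/
def errorBound (β₁ β₂ β₃ β₄ β₅ β₆ κ h T D : ℝ) : ℝ :=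
  β₁ * κ * D * h ^ (1 / 2 : ℝ) + β₂ * κ * h
    + κ * (4 * Real.sqrt (6 * κ) + β₃) * β₄ * Real.sqrt T * h ^ (3 / 2 : ℝ)
    + β₅ * Real.sqrt T * h ^ 3 + β₆ * Real.sqrt T * h ^ (7 / 2 : ℝ)

/-- The error bound for all knot sequences of mesh size at most `1` and all minimizers of the
penalty at uniform distance less than `δ` from `x`. -/
def ErrorBoundHolds (F : ℝ → ℝ → ℝ) (T x₀ : ℝ) (x : ℝ → ℝ)
    (δ β₁ β₂ β₃ β₄ β₅ β₆ : ℝ) : Prop :=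
  ∀ τ : Knots T, τ.mesh ≤ 1 → ∀ s ∈ minimizers F τ x₀ x δ,
    supNorm T (fun t => x t - s t) <
      errorBound β₁ β₂ β₃ β₄ β₅ β₆ τ.ratio τ.mesh T
        (l2Norm T (iteratedDerivWithin 2 s (Icc 0 T)))

/-- Quantitative control of a solution `x` and of `F` near it: `M` bounds `|x'|`, `|x''|`, `|x''''|`
on `[0, T]` and `|F|`, `|F_x|`, `|F_t|` on the tube of radius `δ` around `x`, on which moreover
`F_x ≤ -γ`. -/
structure Controlled (F : ℝ → ℝ → ℝ) (T : ℝ) (x : ℝ → ℝ) (M γ δ : ℝ) : Prop where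
  deriv_le : ∀ k ∈ ({1, 2, 4} : Set ℕ), ∀ t ∈ Icc 0 T,
    |iteratedDerivWithin k x (Icc 0 T) t| ≤ M
  F_le : ∀ t ∈ Icc 0 T, ∀ y, |y - x t| ≤ δ → |F y t| ≤ M
  Fx_le : ∀ t ∈ Icc 0 T, ∀ y, |y - x t| ≤ δ → |deriv (fun z => F z t) y| ≤ M
  Ft_le : ∀ t ∈ Icc 0 T, ∀ y, |y - x t| ≤ δ → |deriv (fun u => F y u) t| ≤ M
  Fx_neg : ∀ t ∈ Icc 0 T, ∀ y, |y - x t| ≤ δ → deriv (fun z => F z t) y ≤ -γ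

end

end SplineODE

/-! The bound F_x ≤ -γ < 0 makes the flow contractive. If s(0) = x₀, s stays in the tube and r = s'
- F(s, t), then e = s - x satisfies (e²)' ≤ -2γe² + 2er ≤ r²/(2γ), hence e² ≤ J(s)/(2γ) with no
factor exponential in T (`sq_sub_le_penalty`).

A minimizer has J(s) ≤ J(w) for every admissible spline w, so one good competitor suffices. It is
the clamped cubic spline interpolant of x, whose value and derivative errors are at most 12Bh³ and
12Bh² when |x'''| ≤ B (`exists_cubicSpline_approx`); the bounds on x'' and x'''' give B = 3M/min(1,
T) (`abs_deriv_le_of_bounds`). The distance is therefore of order √T h²/min(1, T), which is at most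
h + √T h^(3/2) because h ≤ min(1, T). If the error bound does not place the interpolant inside the
tube, then δ itself is at most 36Mh, and so is the distance from s to x.

Thus the β₂ and β₄ terms carry the estimate; the others are nonnegative and make it strict. The
first claim follows from the second, since compactness turns F_x < 0 along x into uniform control on
a tube (`exists_controlled`). -/

namespace SplineODE

/-! ### Tridiagonal systems -/

/-- A two-step recursion has a solution with any two given initial values. -/
theorem exists_two_step_recursion (f : ℕ → ℝ → ℝ → ℝ) (α β : ℝ) :
    ∃ m : ℕ → ℝ, m 0 = α ∧ m 1 = β ∧ ∀ i, m (i + 2) = f i (m i) (m (i + 1)) := by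
  let q : ℕ → ℝ × ℝ := fun n => Nat.rec (α, β) (fun i p => (p.2, f i p.1 p.2)) n
  exact ⟨fun n => (q n).1, rfl, rfl, fun i => rfl⟩

/-- A diagonally dominant tridiagonal system with prescribed first and last unknown is solvable. -/
theorem exists_tridiagonal_solution (a g : ℕ → ℝ) (ha : ∀ i, 0 < a i) (α β : ℝ) (N : ℕ)
    (hN : 0 < N) :
    ∃ m : ℕ → ℝ, m 0 = α ∧ m N = β ∧
      ∀ i, a i * m i + 2 * (a i + a (i + 1)) * m (i + 1) + a (i + 1) * m (i + 2) = g i := by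
  -- Shooting: `p` has the right value at 0, and a multiple of the homogeneous solution `v`, which
  -- vanishes at 0, corrects its value at `N`.
  obtain ⟨p, hp0, -, hp⟩ := exists_two_step_recursion
    (fun i y z => (g i - a i * y - 2 * (a i + a (i + 1)) * z) / a (i + 1)) α 0
  obtain ⟨v, hv0, hv1, hv⟩ := exists_two_step_recursion
    (fun i y z => (- a i * y - 2 * (a i + a (i + 1)) * z) / a (i + 1)) 0 1
  -- Diagonal dominance keeps |v| from decreasing after v 1 = 1, so v N ≠ 0.
  have hgrow : ∀ i, |v i| ≤ |v (i + 1)| ∧ 1 ≤ |v (i + 1)| := by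
    intro i
    induction i with
    | zero => simp [hv0, hv1]
    | succ i ih =>
      have h1 : a (i + 1) * v (i + 2) = - a i * v i - 2 * (a i + a (i + 1)) * v (i + 1) := by
        rw [hv i]; field_simp [(ha (i + 1)).ne']
      have h2 : a (i + 1) * |v (i + 2)| + a i * |v i| ≥ 2 * (a i + a (i + 1)) * |v (i + 1)| := by
        have : |2 * (a i + a (i + 1)) * v (i + 1)| ≤ |a (i + 1) * v (i + 2)| + |a i * v i| := by
          rw [show 2 * (a i + a (i + 1)) * v (i + 1)
            = -(a (i + 1) * v (i + 2) + a i * v i) by linarith, abs_neg]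
          exact abs_add_le _ _
        rwa [abs_mul, abs_mul (a (i + 1)), abs_mul (a i), abs_of_pos (ha i),
          abs_of_pos (ha (i + 1)), abs_of_pos (by linarith [ha i, ha (i + 1)])] at this
      have h3 : |v (i + 1)| ≤ |v (i + 2)| := by
        have h4 := mul_le_mul_of_nonneg_left ih.1 (ha i).le
        have h5 := mul_nonneg (ha i).le (abs_nonneg (v (i + 1)))
        have h6 := mul_nonneg (ha (i + 1)).le (abs_nonneg (v (i + 1)))
        refine le_of_mul_le_mul_left ?_ (ha (i + 1))
        nlinarith
      exact ⟨h3, ih.2.trans h3⟩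
  have hvN : v N ≠ 0 := by
    obtain ⟨k, rfl⟩ := Nat.exists_eq_succ_of_ne_zero hN.ne'
    have := (hgrow k).2
    intro h0
    simp only [Nat.succ_eq_add_one] at h0
    rw [h0] at this
    norm_num at this
  refine ⟨fun i => p i + (β - p N) / v N * v i, by simp [hp0, hv0], by field_simp; ring, ?_⟩
  intro i
  have hA := (ha (i + 1)).ne'
  simp only [hp i, hv i]
  field_simp
  ring

/-- The maximum principle for diagonally dominant tridiagonal systems. -/
theorem abs_le_of_tridiagonal (a e : ℕ → ℝ) (ha : ∀ i, 0 < a i) (N : ℕ) (R : ℝ) (hR : 0 ≤ R)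
    (h0 : e 0 = 0) (hN : e N = 0)
    (h : ∀ i, i + 1 < N →
      |a i * e i + 2 * (a i + a (i + 1)) * e (i + 1) + a (i + 1) * e (i + 2)|
        ≤ (a i + a (i + 1)) * R) :
    ∀ i ≤ N, |e i| ≤ R := by
  -- Where |e| is largest, the two neighbours cancel at most half of the diagonal term; the other
  -- half is bounded by the right-hand side.
  obtain ⟨j, hj, hmax⟩ := Finset.exists_max_image (Finset.range (N + 1)) (fun i => |e i|) (by simp)
  suffices |e j| ≤ R from fun i hi => (hmax i (by simpa [Nat.lt_succ_iff] using hi)).trans this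
  have hjN : j ≤ N := by simpa [Nat.lt_succ_iff] using hj
  rcases Nat.eq_zero_or_pos j with rfl | hj0
  · simpa [h0] using hR
  rcases hjN.eq_or_lt with rfl | hlt
  · simpa [hN] using hR
  obtain ⟨i, rfl⟩ := Nat.exists_eq_succ_of_ne_zero hj0.ne'
  have h1 := h i hlt
  have h2 := hmax i (by simp; omega)
  have h3 := hmax (i + 2) (by simp at hlt ⊢; omega)
  simp only [Nat.succ_eq_add_one] at h2 h3 ⊢
  have h4 : |2 * (a i + a (i + 1)) * e (i + 1)| ≤
      |a i * e i + 2 * (a i + a (i + 1)) * e (i + 1) + a (i + 1) * e (i + 2)|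
        + (|a i * e i| + |a (i + 1) * e (i + 2)|) := by
    have := abs_add_le (a i * e i + 2 * (a i + a (i + 1)) * e (i + 1) + a (i + 1) * e (i + 2))
      (-(a i * e i + a (i + 1) * e (i + 2)))
    rw [abs_neg] at this
    have h5 := abs_add_le (a i * e i) (a (i + 1) * e (i + 2))
    have h6 : a i * e i + 2 * (a i + a (i + 1)) * e (i + 1) + a (i + 1) * e (i + 2)
      + -(a i * e i + a (i + 1) * e (i + 2)) = 2 * (a i + a (i + 1)) * e (i + 1) := by ring
    rw [h6] at this
    linarith
  have hs : 0 < a i + a (i + 1) := by linarith [ha i, ha (i + 1)]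
  rw [abs_mul, abs_mul (a i), abs_mul (a (i + 1)), abs_of_pos (ha i), abs_of_pos (ha (i + 1)),
    abs_of_pos (by linarith)] at h4
  refine le_of_mul_le_mul_left ?_ hs
  nlinarith [mul_le_mul_of_nonneg_left h2 (ha i).le, mul_le_mul_of_nonneg_left h3 (ha (i + 1)).le]

/-! ### Truncated powers and gluing of cubic pieces -/

theorem hasDerivAt_posPart_pow (n : ℕ) (t : ℝ) :
    HasDerivAt (fun u : ℝ => max 0 u ^ (n + 2)) ((n + 2 : ℕ) * max 0 t ^ (n + 1)) t := by
  have hl : ∀ t : ℝ, t ≤ 0 → HasDerivWithinAt (fun u : ℝ => max 0 u ^ (n + 2))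
      ((n + 2 : ℕ) * max 0 t ^ (n + 1)) (Iic 0) t := by
    intro t ht
    rw [max_eq_left ht]
    refine ((hasDerivWithinAt_const t (Iic 0) (0 : ℝ)).congr_deriv (by simp)).congr ?_ ?_
    · intro y hy; simp [max_eq_left (mem_Iic.1 hy)]
    · simp [max_eq_left ht]
  have hr : ∀ t : ℝ, 0 ≤ t → HasDerivWithinAt (fun u : ℝ => max 0 u ^ (n + 2))
      ((n + 2 : ℕ) * max 0 t ^ (n + 1)) (Ici 0) t := by
    intro t ht
    rw [max_eq_right ht]
    refine ((hasDerivAt_pow (n + 2) t).hasDerivWithinAt.congr_deriv (by simp)).congr ?_ ?_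
    · intro y hy; simp [max_eq_right (mem_Ici.1 hy)]
    · simp [max_eq_right ht]
  rcases lt_trichotomy t 0 with ht | rfl | ht
  · exact (hl t ht.le).hasDerivAt (Iic_mem_nhds ht)
  · have := (hl 0 le_rfl).union (hr 0 le_rfl)
    rwa [Iic_union_Ici, hasDerivWithinAt_univ] at this
  · exact (hr t ht.le).hasDerivAt (Ici_mem_nhds ht)

theorem contDiff_posPart_cube : ContDiff ℝ 2 (fun u : ℝ => max 0 u ^ 3) := by
  have h3 : deriv (fun u : ℝ => max 0 u ^ 3) = fun u => 3 * max 0 u ^ 2 := by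
    ext t; simpa using (hasDerivAt_posPart_pow 1 t).deriv
  have h2 : deriv (fun u : ℝ => 3 * max 0 u ^ 2) = fun u => 3 * (2 * max 0 u) := by
    ext t; simpa using ((hasDerivAt_posPart_pow 0 t).const_mul 3).deriv
  rw [show (2 : WithTop ℕ∞) = 1 + 1 from by norm_num, contDiff_succ_iff_deriv]
  refine ⟨fun t => (hasDerivAt_posPart_pow 1 t).differentiableAt, by simp, ?_⟩
  rw [h3, contDiff_one_iff_deriv]
  refine ⟨fun t => ((hasDerivAt_posPart_pow 0 t).const_mul 3).differentiableAt, ?_⟩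
  rw [h2]
  fun_prop

theorem exists_cell (u : ℕ → ℝ) {N : ℕ} (hN : 0 < N) {t : ℝ} (h0 : u 0 ≤ t) (h1 : t ≤ u N) :
    ∃ k < N, t ∈ Icc (u k) (u (k + 1)) := by
  induction N with
  | zero => omega
  | succ N ih =>
    rcases le_total t (u N) with h | h
    · rcases Nat.eq_zero_or_pos N with rfl | hN'
      · exact ⟨0, hN, h0, h1⟩
      · obtain ⟨k, hk, hk'⟩ := ih hN' h
        exact ⟨k, hk.trans (Nat.lt_succ_self _), hk'⟩
    · exact ⟨N, Nat.lt_succ_self _, h, h1⟩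

/-- Functions on consecutive cells whose differences are multiples of the cubes that vanish at the
common knots are the pieces of a single `C²` function. -/
theorem exists_glue (u : ℕ → ℝ) (hu : StrictMono u) (p : ℕ → ℝ → ℝ) (c : ℕ → ℝ) (N : ℕ)
    (hp0 : ContDiff ℝ 2 (p 0))
    (hp : ∀ k, k + 1 < N → ∀ t, p (k + 1) t = p k t + c k * (t - u (k + 1)) ^ 3) :
    ∃ w : ℝ → ℝ, ContDiff ℝ 2 w ∧ ∀ k < N, ∀ t ∈ Icc (u k) (u (k + 1)), w t = p k t := by
  -- Each truncated cube switches on at its own knot, so on cell `k` exactly the terms with i < k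
  -- are active, and they telescope to `p k`.
  refine ⟨fun t => p 0 t + ∑ i ∈ Finset.range (N - 1), c i * max 0 (t - u (i + 1)) ^ 3, ?_, ?_⟩
  · refine hp0.add (ContDiff.sum fun i _ => contDiff_const.mul ?_)
    exact contDiff_posPart_cube.comp (contDiff_id.sub contDiff_const)
  · intro k hk t ht
    have htel : ∀ j, j < N → p j t = p 0 t + ∑ i ∈ Finset.range j, c i * (t - u (i + 1)) ^ 3 := by
      intro j
      induction j with
      | zero => simp
      | succ j ih => intro hj; rw [hp j hj, ih (by omega), Finset.sum_range_succ, add_assoc]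
    rw [htel k hk]
    refine congrArg (p 0 t + ·) ?_
    have hsub : Finset.range k ⊆ Finset.range (N - 1) := Finset.range_mono (by omega)
    rw [← Finset.sum_subset hsub]
    · refine Finset.sum_congr rfl fun i hi => ?_
      have : u (i + 1) ≤ u k := hu.monotone (by simpa using hi)
      rw [max_eq_right (by linarith [ht.1])]
    · intro i _ hi
      have : u (k + 1) ≤ u (i + 1) := hu.monotone (by simpa using hi)
      rw [max_eq_left (by linarith [ht.2])]
      simp

/-! ### Taylor remainders and Hermite interpolation -/

section Taylor

variable {x0 x1 x2 x3 : ℝ → ℝ} {c d B : ℝ}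

theorem abs_sub_le_of_deriv_bound (h2 : ∀ t ∈ Icc c d, HasDerivWithinAt x2 (x3 t) (Icc c d) t)
    (hB : ∀ t ∈ Icc c d, |x3 t| ≤ B) {p q : ℝ} (hp : p ∈ Icc c d) (hq : q ∈ Icc c d) :
    |x2 q - x2 p| ≤ B * |q - p| :=
  Convex.norm_image_sub_le_of_norm_hasDerivWithin_le (f := x2) (f' := x3) h2 hB
    (convex_Icc c d) hp hq

/-- The derivative of a Taylor remainder is the remainder of one order less, so the mean value
inequality between `p` and `q` climbs one order at a time. The factorials are given up; `p` and `q`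
may come in either order. -/
theorem abs_sub_taylor_one_le (h1 : ∀ t ∈ Icc c d, HasDerivWithinAt x1 (x2 t) (Icc c d) t)
    (h2 : ∀ t ∈ Icc c d, HasDerivWithinAt x2 (x3 t) (Icc c d) t)
    (hB : ∀ t ∈ Icc c d, |x3 t| ≤ B) {p q : ℝ} (hp : p ∈ Icc c d) (hq : q ∈ Icc c d) :
    |x1 q - x1 p - (q - p) * x2 p| ≤ B * |q - p| ^ 2 := by
  have hB0 : 0 ≤ B := (abs_nonneg _).trans (hB p hp)
  have hsub : uIcc p q ⊆ Icc c d := uIcc_subset_Icc hp hq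
  have := Convex.norm_image_sub_le_of_norm_hasDerivWithin_le (s := uIcc p q)
    (f := fun t => x1 t - (t - p) * x2 p) (f' := fun t => x2 t - 1 * x2 p) (C := B * |q - p|)
    (fun t ht => ((h1 t (hsub ht)).mono hsub).sub
      (((hasDerivWithinAt_id t _).sub_const p).mul_const (x2 p)))
    (fun t ht => by
      rw [one_mul]
      refine (abs_sub_le_of_deriv_bound h2 hB hp (hsub ht)).trans ?_
      exact mul_le_mul_of_nonneg_left (abs_sub_left_of_mem_uIcc ht) hB0)
    (convex_uIcc p q) left_mem_uIcc right_mem_uIcc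
  simp only [Real.norm_eq_abs] at this
  calc |x1 q - x1 p - (q - p) * x2 p| = |x1 q - (q - p) * x2 p - (x1 p - (p - p) * x2 p)| := by
        congr 1; ring
    _ ≤ _ := this
    _ = _ := by ring

theorem abs_sub_taylor_two_le (h0 : ∀ t ∈ Icc c d, HasDerivWithinAt x0 (x1 t) (Icc c d) t)
    (h1 : ∀ t ∈ Icc c d, HasDerivWithinAt x1 (x2 t) (Icc c d) t)
    (h2 : ∀ t ∈ Icc c d, HasDerivWithinAt x2 (x3 t) (Icc c d) t)
    (hB : ∀ t ∈ Icc c d, |x3 t| ≤ B) {p q : ℝ} (hp : p ∈ Icc c d) (hq : q ∈ Icc c d) :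
    |x0 q - x0 p - (q - p) * x1 p - (q - p) ^ 2 / 2 * x2 p| ≤ B * |q - p| ^ 3 := by
  have hB0 : 0 ≤ B := (abs_nonneg _).trans (hB p hp)
  have hsub : uIcc p q ⊆ Icc c d := uIcc_subset_Icc hp hq
  have := Convex.norm_image_sub_le_of_norm_hasDerivWithin_le (s := uIcc p q)
    (f := fun t => x0 t - (t - p) * x1 p - (t - p) ^ 2 / 2 * x2 p)
    (f' := fun t => x1 t - x1 p - (t - p) * x2 p) (C := B * |q - p| ^ 2)
    (fun t ht => by
      have e1 := (hasDerivWithinAt_id t (uIcc p q)).sub_const p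
      have := (((h0 t (hsub ht)).mono hsub).sub (e1.mul_const (x1 p))).sub
        (((e1.pow 2).div_const 2).mul_const (x2 p))
      refine this.congr_deriv ?_
      simp)
    (fun t ht => by
      refine (abs_sub_taylor_one_le h1 h2 hB hp (hsub ht)).trans ?_
      exact mul_le_mul_of_nonneg_left
        (pow_le_pow_left₀ (abs_nonneg _) (abs_sub_left_of_mem_uIcc ht) 2) hB0)
    (convex_uIcc p q) left_mem_uIcc right_mem_uIcc
  simp only [Real.norm_eq_abs] at this
  calc |x0 q - x0 p - (q - p) * x1 p - (q - p) ^ 2 / 2 * x2 p|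
      = |x0 q - (q - p) * x1 p - (q - p) ^ 2 / 2 * x2 p
          - (x0 p - (p - p) * x1 p - (p - p) ^ 2 / 2 * x2 p)| := by
        congr 1; ring
    _ ≤ _ := this
    _ = _ := by ring

theorem abs_slope_sub_le (h0 : ∀ t ∈ Icc c d, HasDerivWithinAt x0 (x1 t) (Icc c d) t)
    (h1 : ∀ t ∈ Icc c d, HasDerivWithinAt x1 (x2 t) (Icc c d) t)
    (h2 : ∀ t ∈ Icc c d, HasDerivWithinAt x2 (x3 t) (Icc c d) t)
    (hB : ∀ t ∈ Icc c d, |x3 t| ≤ B) {p q : ℝ} (hp : p ∈ Icc c d) (hq : q ∈ Icc c d)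
    (hpq : p ≠ q) :
    |(x0 q - x0 p) / (q - p) - x1 p - (q - p) / 2 * x2 p| ≤ B * |q - p| ^ 2 := by
  have hne : q - p ≠ 0 := sub_ne_zero.2 hpq.symm
  have h := abs_sub_taylor_two_le h0 h1 h2 hB hp hq
  have heq : x0 q - x0 p - (q - p) * x1 p - (q - p) ^ 2 / 2 * x2 p
      = (q - p) * ((x0 q - x0 p) / (q - p) - x1 p - (q - p) / 2 * x2 p) := by
    field_simp
  rw [heq, abs_mul] at h
  refine le_of_mul_le_mul_left (h.trans_eq (by ring)) (abs_pos.2 hne)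

/-- The consistency error of one half of the equation for the slopes of a cubic spline. -/
theorem abs_spline_consistency_le (h0 : ∀ t ∈ Icc c d, HasDerivWithinAt x0 (x1 t) (Icc c d) t)
    (h1 : ∀ t ∈ Icc c d, HasDerivWithinAt x1 (x2 t) (Icc c d) t)
    (h2 : ∀ t ∈ Icc c d, HasDerivWithinAt x2 (x3 t) (Icc c d) t)
    (hB : ∀ t ∈ Icc c d, |x3 t| ≤ B) {p q : ℝ} (hp : p ∈ Icc c d) (hq : q ∈ Icc c d)
    (hpq : p ≠ q) :
    |3 * ((x0 q - x0 p) / (q - p)) - x1 q - 2 * x1 p - (q - p) / 2 * x2 p|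
      ≤ 4 * B * |q - p| ^ 2 := by
  -- The constant is 4 = 3 + 1: three slope errors and one error of x1.
  have e0 := abs_le.1 (abs_slope_sub_le h0 h1 h2 hB hp hq hpq)
  have e1 := abs_le.1 (abs_sub_taylor_one_le h1 h2 hB hp hq)
  rw [abs_le]
  constructor <;> linarith [e0.1, e0.2, e1.1, e1.2]

/-- The derivative of a cubic Hermite interpolant, with slopes that are accurate up to `ε`. -/
theorem abs_hermite_deriv_sub_le (h0 : ∀ t ∈ Icc c d, HasDerivWithinAt x0 (x1 t) (Icc c d) t)
    (h1 : ∀ t ∈ Icc c d, HasDerivWithinAt x1 (x2 t) (Icc c d) t)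
    (h2 : ∀ t ∈ Icc c d, HasDerivWithinAt x2 (x3 t) (Icc c d) t)
    (hB : ∀ t ∈ Icc c d, |x3 t| ≤ B) {p q t m n ε : ℝ} (hp : p ∈ Icc c d) (hq : q ∈ Icc c d)
    (hpq : p < q) (ht : t ∈ Icc p q) (hm : |m - x1 p| ≤ ε) (hn : |n - x1 q| ≤ ε) :
    |m + 2 * ((3 * ((x0 q - x0 p) / (q - p)) - 2 * m - n) / (q - p)) * (t - p)
      + 3 * ((m + n - 2 * ((x0 q - x0 p) / (q - p))) / (q - p) ^ 2) * (t - p) ^ 2 - x1 t|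
      ≤ 2 * ε + 4 * B * (q - p) ^ 2 := by
  have hh : 0 < q - p := sub_pos.2 hpq
  have hB0 : 0 ≤ B := (abs_nonneg _).trans (hB p hp)
  have htc : t ∈ Icc c d := ⟨hp.1.trans ht.1, ht.2.trans hq.2⟩
  have e0 := abs_slope_sub_le h0 h1 h2 hB hp hq hpq.ne
  have e1 := abs_sub_taylor_one_le h1 h2 hB hp hq
  have e2 := abs_sub_taylor_one_le h1 h2 hB hp htc
  rw [abs_of_pos hh] at e0 e1
  have e2' : |x1 t - x1 p - (t - p) * x2 p| ≤ B * (q - p) ^ 2 := by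
    refine e2.trans (mul_le_mul_of_nonneg_left ?_ hB0)
    rw [abs_of_nonneg (sub_nonneg.2 ht.1)]
    exact pow_le_pow_left₀ (sub_nonneg.2 ht.1) (by linarith [ht.2]) 2
  set s := (x0 q - x0 p) / (q - p) with hs
  set θ := (t - p) / (q - p) with hθ
  have hθ0 : 0 ≤ θ := div_nonneg (sub_nonneg.2 ht.1) hh.le
  have hθ1 : θ ≤ 1 := (div_le_one hh).2 (by linarith [ht.2])
  have htp : t - p = θ * (q - p) := by rw [hθ]; field_simp
  -- Hermite interpolation is exact on quadratics, so only the slope errors and Taylor remainders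
  -- survive. The weights in θ are bounded by 1, 1, 1, 2, 1, which gives 2ε and 4 = 1 + 2 + 1.
  have hdecomp : m + 2 * ((3 * s - 2 * m - n) / (q - p)) * (t - p)
      + 3 * ((m + n - 2 * s) / (q - p) ^ 2) * (t - p) ^ 2 - x1 t
      = (m - x1 p) * (1 - 4 * θ + 3 * θ ^ 2) + (n - x1 q) * (3 * θ ^ 2 - 2 * θ)
        + (x1 q - x1 p - (q - p) * x2 p) * (3 * θ ^ 2 - 2 * θ)
        + (s - x1 p - (q - p) / 2 * x2 p) * (6 * θ * (1 - θ))
        - (x1 t - x1 p - (t - p) * x2 p) := by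
    rw [htp]; field_simp; ring
  have hprod : ∀ {y z R K : ℝ}, |y| ≤ R → |z| ≤ K → |y * z| ≤ R * K := by
    intro y z R K hy hz
    rw [abs_mul]
    exact mul_le_mul hy hz (abs_nonneg _) ((abs_nonneg _).trans hy)
  have k0 : |1 - 4 * θ + 3 * θ ^ 2| ≤ 1 := by rw [abs_le]; constructor <;> nlinarith
  have k1 : |3 * θ ^ 2 - 2 * θ| ≤ 1 := by rw [abs_le]; constructor <;> nlinarith
  have k2 : |6 * θ * (1 - θ)| ≤ 2 := by
    rw [abs_le]; constructor <;> nlinarith [sq_nonneg (2 * θ - 1)]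
  have a1 := abs_le.1 (hprod hm k0)
  have a2 := abs_le.1 (hprod hn k1)
  have a3 := abs_le.1 (hprod e1 k1)
  have a4 := abs_le.1 (hprod e0 k2)
  have a5 := abs_le.1 e2'
  rw [hdecomp, abs_le]
  constructor <;> linarith [a1.1, a1.2, a2.1, a2.2, a3.1, a3.2, a4.1, a4.2, a5.1, a5.2]

end Taylor

/-! ### Clamped cubic spline interpolation -/

/-- The clamped cubic spline interpolant of a function with bounded third derivative. -/
theorem exists_cubicSpline_approx (u : ℕ → ℝ) (hu : StrictMono u) {N : ℕ} (hN : 0 < N)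
    {h B : ℝ} (hh : ∀ i < N, u (i + 1) - u i ≤ h) {x0 x1 x2 x3 : ℝ → ℝ}
    (h0 : ∀ t ∈ Icc (u 0) (u N), HasDerivWithinAt x0 (x1 t) (Icc (u 0) (u N)) t)
    (h1 : ∀ t ∈ Icc (u 0) (u N), HasDerivWithinAt x1 (x2 t) (Icc (u 0) (u N)) t)
    (h2 : ∀ t ∈ Icc (u 0) (u N), HasDerivWithinAt x2 (x3 t) (Icc (u 0) (u N)) t)
    (hB : ∀ t ∈ Icc (u 0) (u N), |x3 t| ≤ B) :
    ∃ w : ℝ → ℝ, ContDiff ℝ 2 w ∧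
      (∀ k < N, ∃ p : Polynomial ℝ, p.natDegree ≤ 3 ∧
        ∀ t ∈ Icc (u k) (u (k + 1)), w t = p.eval t) ∧
      w (u 0) = x0 (u 0) ∧
      ∀ t ∈ Icc (u 0) (u N), |w t - x0 t| ≤ 12 * B * h ^ 3 ∧ |deriv w t - x1 t| ≤ 12 * B * h ^ 2 := by
  have hpos : ∀ i, 0 < u (i + 1) - u i := fun i => sub_pos.2 (hu (Nat.lt_succ_self i))
  have hmem : ∀ i ≤ N, u i ∈ Icc (u 0) (u N) :=
    fun i hi => ⟨hu.monotone (Nat.zero_le i), hu.monotone hi⟩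
  have hB0 : 0 ≤ B := (abs_nonneg _).trans (hB _ (hmem 0 (Nat.zero_le _)))
  have hh0 : 0 ≤ h := (hpos 0).le.trans (hh 0 hN)
  let sl : ℕ → ℝ := fun i => (x0 (u (i + 1)) - x0 (u i)) / (u (i + 1) - u i)
  let a : ℕ → ℝ := fun i => 1 / (u (i + 1) - u i)
  have ha : ∀ i, 0 < a i := fun i => one_div_pos.2 (hpos i)
  -- The unknowns are the slopes at the knots. Equation `i` says that the second derivatives of the
  -- two adjacent Hermite cubics agree at u (i + 1); the end slopes are those of the given function.
  obtain ⟨m, hm0, hmN, hm⟩ := exists_tridiagonal_solution a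
    (fun i => 3 * (a i * sl i + a (i + 1) * sl (i + 1))) ha (x1 (u 0)) (x1 (u N)) N hN
  have hslope : ∀ i ≤ N, |m i - x1 (u i)| ≤ 4 * B * h ^ 2 := by
    refine abs_le_of_tridiagonal a (fun i => m i - x1 (u i)) ha N _ (by positivity)
      (by simp [hm0]) (by simp [hmN]) fun i hi => ?_
    have r1 := abs_spline_consistency_le h0 h1 h2 hB (hmem (i + 1) hi.le) (hmem i (by omega))
      (hu (Nat.lt_succ_self i)).ne'
    have r2 := abs_spline_consistency_le h0 h1 h2 hB (hmem (i + 1) hi.le) (hmem (i + 2) hi)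
      (hu (Nat.lt_succ_self (i + 1))).ne
    have s1 : |u i - u (i + 1)| ^ 2 ≤ h ^ 2 := by
      rw [abs_sub_comm, abs_of_pos (hpos i)]
      exact pow_le_pow_left₀ (hpos i).le (hh i (by omega)) 2
    have s2 : |u (i + 2) - u (i + 1)| ^ 2 ≤ h ^ 2 := by
      rw [abs_of_pos (hpos (i + 1))]
      exact pow_le_pow_left₀ (hpos (i + 1)).le (hh (i + 1) hi) 2
    have r1' := r1.trans (mul_le_mul_of_nonneg_left s1 (by positivity))
    have r2' := r2.trans (mul_le_mul_of_nonneg_left s2 (by positivity))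
    have hsl : (x0 (u i) - x0 (u (i + 1))) / (u i - u (i + 1)) = sl i := by
      rw [← neg_sub, ← neg_sub (u (i + 1)), neg_div_neg_eq]
    have hsl' : (x0 (u (i + 2)) - x0 (u (i + 1))) / (u (i + 2) - u (i + 1)) = sl (i + 1) := rfl
    rw [hsl] at r1'
    rw [hsl'] at r2'
    -- With reciprocal gaps as weights, the x2 terms from the left and right cells cancel, so the
    -- consistency error is of second order on any mesh.
    have z1 : a i * (u i - u (i + 1)) = -1 := by
      have := (hpos i).ne'
      simp only [a]; field_simp; ring
    have z2 : a (i + 1) * (u (i + 2) - u (i + 1)) = 1 := by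
      have := (hpos (i + 1)).ne'
      simp only [a]; field_simp
    have key : a i * (m i - x1 (u i)) + 2 * (a i + a (i + 1)) * (m (i + 1) - x1 (u (i + 1)))
          + a (i + 1) * (m (i + 2) - x1 (u (i + 2)))
        = a i * (3 * sl i - x1 (u i) - 2 * x1 (u (i + 1))
            - (u i - u (i + 1)) / 2 * x2 (u (i + 1)))
          + a (i + 1) * (3 * sl (i + 1) - x1 (u (i + 2)) - 2 * x1 (u (i + 1))
            - (u (i + 2) - u (i + 1)) / 2 * x2 (u (i + 1))) := by
      linear_combination hm i + (x2 (u (i + 1)) / 2) * (z1 + z2)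
    rw [key]
    refine (abs_add_le _ _).trans ?_
    rw [abs_mul, abs_mul, abs_of_pos (ha i), abs_of_pos (ha (i + 1)), add_mul]
    exact add_le_add (mul_le_mul_of_nonneg_left r1' (ha i).le)
      (mul_le_mul_of_nonneg_left r2' (ha (i + 1)).le)
  let A : ℕ → ℝ := fun i => (3 * sl i - 2 * m i - m (i + 1)) / (u (i + 1) - u i)
  let C : ℕ → ℝ := fun i => (m i + m (i + 1) - 2 * sl i) / (u (i + 1) - u i) ^ 2
  let p : ℕ → ℝ → ℝ := fun i t =>
    x0 (u i) + m i * (t - u i) + A i * (t - u i) ^ 2 + C i * (t - u i) ^ 3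
  have hp_deriv : ∀ k t, HasDerivAt (p k)
      (m k + 2 * A k * (t - u k) + 3 * C k * (t - u k) ^ 2) t := by
    intro k t
    have e := (hasDerivAt_id t).sub_const (u k)
    have := ((((e.const_mul (m k)).const_add (x0 (u k))).add ((e.pow 2).const_mul (A k))).add
      ((e.pow 3).const_mul (C k)))
    refine this.congr_deriv ?_
    simp; ring
  obtain ⟨w, hw, hwp⟩ := exists_glue u hu p (fun i => C (i + 1) - C i) N
    (by simp only [p]; fun_prop) (by
      intro k _ t
      have g1 := (hpos k).ne'
      have g2 := (hpos (k + 1)).ne'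
      have v0 : x0 (u (k + 1)) = x0 (u k) + m k * (u (k + 1) - u k) + A k * (u (k + 1) - u k) ^ 2
          + C k * (u (k + 1) - u k) ^ 3 := by
        simp only [A, C, sl]; field_simp; ring
      have v1 : m (k + 1) = m k + 2 * A k * (u (k + 1) - u k)
          + 3 * C k * (u (k + 1) - u k) ^ 2 := by
        simp only [A, C, sl]; field_simp; ring
      -- Values and slopes match by Hermite interpolation; matching second derivatives is the
      -- tridiagonal equation. Adjacent pieces then differ only in the cubic coefficient.
      have v2 : A (k + 1) = A k + 3 * C k * (u (k + 1) - u k) := by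
        have := hm k
        have w1 : A (k + 1) = a (k + 1) * (3 * sl (k + 1) - 2 * m (k + 1) - m (k + 2)) := by
          simp only [A, a]; ring
        have w2 : A k + 3 * C k * (u (k + 1) - u k)
            = a k * (- 3 * sl k + m k + 2 * m (k + 1)) := by
          simp only [A, a, C]; field_simp; ring
        rw [w1, w2]
        linear_combination -this
      simp only [p]
      rw [v0, v1, v2]
      ring)
  have hcell_deriv : ∀ k < N, ∀ t ∈ Icc (u k) (u (k + 1)),
      |deriv w t - x1 t| ≤ 12 * B * h ^ 2 := by
    intro k hk t ht
    have hlt := hu (Nat.lt_succ_self k)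
    have e1 : HasDerivWithinAt w (deriv w t) (Icc (u k) (u (k + 1))) t :=
      (hw.differentiable (by norm_num) t).hasDerivAt.hasDerivWithinAt
    have e2 : HasDerivWithinAt w (m k + 2 * A k * (t - u k) + 3 * C k * (t - u k) ^ 2)
        (Icc (u k) (u (k + 1))) t :=
      (hp_deriv k t).hasDerivWithinAt.congr (hwp k hk) (hwp k hk t ht)
    rw [(uniqueDiffOn_Icc hlt t ht).eq_deriv _ e1 e2]
    have := abs_hermite_deriv_sub_le h0 h1 h2 hB (hmem k hk.le) (hmem (k + 1) hk) hlt ht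
      (hslope k hk.le) (hslope (k + 1) hk)
    refine this.trans ?_
    -- Slopes accurate to ε = 4Bh² give 2ε + 4Bh² = 12Bh².
    nlinarith [mul_le_mul_of_nonneg_left (pow_le_pow_left₀ (hpos k).le (hh k hk) 2) hB0]
  have hw0 : ∀ k < N, w (u k) = x0 (u k) := by
    intro k hk
    rw [hwp k hk _ ⟨le_rfl, (hu (Nat.lt_succ_self k)).le⟩]
    simp [p]
  refine ⟨w, hw, fun k hk => ?_, hw0 0 hN, fun t ht => ?_⟩
  · refine ⟨Polynomial.C (x0 (u k)) + Polynomial.C (m k) * (Polynomial.X - Polynomial.C (u k))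
      + Polynomial.C (A k) * (Polynomial.X - Polynomial.C (u k)) ^ 2
      + Polynomial.C (C k) * (Polynomial.X - Polynomial.C (u k)) ^ 3, by compute_degree, ?_⟩
    intro t ht
    rw [hwp k hk t ht]
    simp [p]
  · obtain ⟨k, hk, hkt⟩ := exists_cell u hN ht.1 ht.2
    refine ⟨?_, hcell_deriv k hk t hkt⟩
    have hsub : Icc (u k) (u (k + 1)) ⊆ Icc (u 0) (u N) :=
      Icc_subset_Icc (hmem k hk.le).1 (hmem (k + 1) hk).2
    -- The value error vanishes at the left knot of the cell, so the derivative bound gains one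
    -- factor `h`.
    have := Convex.norm_image_sub_le_of_norm_hasDerivWithin_le (s := Icc (u k) (u (k + 1)))
      (f := fun t => w t - x0 t) (f' := fun t => deriv w t - x1 t)
      (fun t ht => ((hw.differentiable (by norm_num) t).hasDerivAt.hasDerivWithinAt).sub
        ((h0 t (hsub ht)).mono hsub))
      (hcell_deriv k hk) (convex_Icc _ _) (left_mem_Icc.2 (hu (Nat.lt_succ_self k)).le) hkt
    simp only [hw0 k hk, sub_self, sub_zero, Real.norm_eq_abs] at this
    refine this.trans ?_
    have ht' : |t - u k| ≤ h := by
      rw [abs_of_nonneg (sub_nonneg.2 hkt.1)]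
      linarith [hkt.2, hh k hk]
    calc 12 * B * h ^ 2 * |t - u k| ≤ 12 * B * h ^ 2 * h :=
          mul_le_mul_of_nonneg_left ht' (by positivity)
      _ = 12 * B * h ^ 3 := by ring

/-! ### Uniform norm and knot sequences -/

/-- Continuity matters: the real supremum of an unbounded family has the default value 0. -/
theorem abs_le_supNorm {T : ℝ} {f : ℝ → ℝ} (hf : ContinuousOn f (Icc 0 T)) {t : ℝ}
    (ht : t ∈ Icc 0 T) : |f t| ≤ supNorm T f := by
  have hb : BddAbove ((fun t => |f t|) '' Icc 0 T) := (isCompact_Icc.image_of_continuousOn hf.abs).bddAbove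
  have : BddAbove (range fun t : Icc (0 : ℝ) T => |f t|) := by
    rwa [image_eq_range] at hb
  exact le_ciSup this ⟨t, ht⟩

theorem supNorm_le {T : ℝ} (hT : 0 < T) {f : ℝ → ℝ} {C : ℝ} (h : ∀ t ∈ Icc 0 T, |f t| ≤ C) :
    supNorm T f ≤ C := by
  have : Nonempty (Icc (0 : ℝ) T) := ⟨⟨0, le_rfl, hT.le⟩⟩
  exact ciSup_le fun t => h t t.2

section Knots

variable {T : ℝ} (τ : Knots T)

theorem Knots.gap_pos (i : Fin (τ.n + 1)) : 0 < τ.gap i :=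
  sub_pos.2 (τ.strictMono (Fin.castSucc_lt_succ))

theorem Knots.gap_le_mesh (i : Fin (τ.n + 1)) : τ.gap i ≤ τ.mesh :=
  le_ciSup (f := τ.gap) (finite_range _).bddAbove i

theorem Knots.mesh_pos : 0 < τ.mesh := (τ.gap_pos 0).trans_le (τ.gap_le_mesh 0)

theorem Knots.one_le_ratio : 1 ≤ τ.ratio := by
  obtain ⟨i, hi⟩ := exists_eq_ciInf_of_finite (f := τ.gap)
  unfold Knots.ratio
  rw [← hi, one_le_div (τ.gap_pos i)]
  exact τ.gap_le_mesh i

theorem Knots.mem_Icc (i : Fin (τ.n + 2)) : τ.t i ∈ Icc 0 T := by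
  have h1 := τ.strictMono.monotone (Fin.zero_le i)
  have h2 := τ.strictMono.monotone (Fin.le_last i)
  rw [τ.first] at h1
  rw [τ.last] at h2
  exact ⟨h1, h2⟩

theorem Knots.mesh_le : τ.mesh ≤ T :=
  ciSup_le fun i => by
    have h1 := τ.mem_Icc i.castSucc
    have h2 := τ.mem_Icc i.succ
    unfold Knots.gap
    linarith [h1.1, h2.2]

/-- Every knot sequence extends to an infinite strictly increasing sequence. -/
theorem Knots.exists_extension :
    ∃ u : ℕ → ℝ, StrictMono u ∧ ∀ i : Fin (τ.n + 2), u i = τ.t i := by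
  -- Past T the knots continue with unit spacing, so recursions over ℕ need no special case at the
  -- last knot.
  refine ⟨fun i => if h : i < τ.n + 2 then τ.t ⟨i, h⟩ else T + ((i : ℝ) - (τ.n + 1)),
    strictMono_nat_of_lt_succ fun i => ?_, fun i => by simp⟩
  by_cases h1 : i + 1 < τ.n + 2
  · have h0 : i < τ.n + 2 := by omega
    simp only [h1, h0, dif_pos]
    exact τ.strictMono (Fin.mk_lt_mk.2 (Nat.lt_succ_self i))
  · by_cases h0 : i < τ.n + 2
    · simp only [h1, h0, dif_pos, dif_neg, not_false_eq_true]
      have h2 := (τ.mem_Icc ⟨i, h0⟩).2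
      have h3 : i = τ.n + 1 := by omega
      have h4 : (i : ℝ) = τ.n + 1 := by exact_mod_cast h3
      push_cast
      linarith
    · simp only [h1, h0, dif_neg, not_false_eq_true]
      push_cast
      linarith

end Knots

/-- Cubic splines approximate a function with bounded third derivative, to second order in the
derivative. -/
theorem exists_mem_cubicSplines_approx {T : ℝ} (τ : Knots T) {B : ℝ}
    {x0 x1 x2 x3 : ℝ → ℝ}
    (h0 : ∀ t ∈ Icc 0 T, HasDerivWithinAt x0 (x1 t) (Icc 0 T) t)
    (h1 : ∀ t ∈ Icc 0 T, HasDerivWithinAt x1 (x2 t) (Icc 0 T) t)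
    (h2 : ∀ t ∈ Icc 0 T, HasDerivWithinAt x2 (x3 t) (Icc 0 T) t)
    (hB : ∀ t ∈ Icc 0 T, |x3 t| ≤ B) :
    ∃ w ∈ cubicSplines τ, ContDiff ℝ 2 w ∧ w 0 = x0 0 ∧
      ∀ t ∈ Icc 0 T, |w t - x0 t| ≤ 12 * B * τ.mesh ^ 3 ∧
        |deriv w t - x1 t| ≤ 12 * B * τ.mesh ^ 2 := by
  obtain ⟨u, hu, hut⟩ := τ.exists_extension
  have hu0 : u 0 = 0 := by simpa [τ.first] using hut 0
  have huN : u (τ.n + 1) = T := by simpa [τ.last] using hut (Fin.last (τ.n + 1))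
  have hgap : ∀ i < τ.n + 1, u (i + 1) - u i ≤ τ.mesh := by
    intro i hi
    have := τ.gap_le_mesh ⟨i, hi⟩
    unfold Knots.gap at this
    rw [← hut, ← hut] at this
    exact this
  obtain ⟨w, hw, hwp, hw0, hwx⟩ := exists_cubicSpline_approx u hu (Nat.succ_pos τ.n) hgap
    (x0 := x0) (x1 := x1) (x2 := x2) (x3 := x3) (B := B)
    (by simpa only [hu0, huN, Nat.succ_eq_add_one] using h0)
    (by simpa only [hu0, huN, Nat.succ_eq_add_one] using h1)
    (by simpa only [hu0, huN, Nat.succ_eq_add_one] using h2)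
    (by simpa only [hu0, huN, Nat.succ_eq_add_one] using hB)
  rw [hu0] at hw0
  simp only [Nat.succ_eq_add_one, hu0, huN] at hwx
  refine ⟨w, ⟨hw.contDiffOn, fun i => ?_⟩, hw, hw0, hwx⟩
  obtain ⟨p, hp, hpw⟩ := hwp i i.2
  refine ⟨p, hp, fun t ht => hpw t ?_⟩
  rw [← hut, ← hut] at ht
  exact ht

/-! ### Regularity of the solution and bounds for its derivatives -/

/-- Bootstrapping: if x is Cⁿ with n ≤ 3, then x' = F(x, t) is Cⁿ, so x is Cⁿ⁺¹. -/
theorem IsSolution.contDiffOn {F : ℝ → ℝ → ℝ} {T x₀ : ℝ} {x : ℝ → ℝ} (hT : 0 < T)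
    (hF : ContDiff ℝ 3 (fun p : ℝ × ℝ => F p.1 p.2)) (hx : IsSolution F T x₀ x) :
    ContDiffOn ℝ 4 x (Icc 0 T) := by
  have hU := uniqueDiffOn_Icc hT
  have hd : ∀ t ∈ Icc 0 T, derivWithin x (Icc 0 T) t = F (x t) t :=
    fun t ht => (hx.2 t ht).derivWithin (hU t ht)
  have step : ∀ n : ℕ, n ≤ 3 → ContDiffOn ℝ n x (Icc 0 T) →
      ContDiffOn ℝ (n + 1 : ℕ) x (Icc 0 T) := by
    intro n hn h
    push_cast
    rw [contDiffOn_succ_iff_derivWithin hU]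
    refine ⟨fun t ht => (hx.2 t ht).differentiableWithinAt, by simp, ?_⟩
    refine ContDiffOn.congr ?_ hd
    have : ContDiff ℝ n (fun p : ℝ × ℝ => F p.1 p.2) := hF.of_le (by exact_mod_cast hn)
    exact this.comp_contDiffOn (h.prodMk contDiffOn_id)
  have c0 : ContDiffOn ℝ (0 : ℕ) x (Icc 0 T) :=
    contDiffOn_zero.2 fun t ht => (hx.2 t ht).continuousWithinAt
  exact_mod_cast step 3 le_rfl (step 2 (by norm_num) (step 1 (by norm_num) (step 0 (by norm_num) c0)))

theorem hasDerivWithinAt_iteratedDerivWithin {T : ℝ} (hT : 0 < T) {x : ℝ → ℝ}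
    (hx : ContDiffOn ℝ 4 x (Icc 0 T)) {k : ℕ} (hk : k < 4) {t : ℝ} (ht : t ∈ Icc 0 T) :
    HasDerivWithinAt (iteratedDerivWithin k x (Icc 0 T))
      (iteratedDerivWithin (k + 1) x (Icc 0 T) t) (Icc 0 T) t := by
  rw [iteratedDerivWithin_succ]
  exact (hx.differentiableOn_iteratedDerivWithin (by exact_mod_cast hk)
    (uniqueDiffOn_Icc hT) t ht).hasDerivWithinAt

/-- A bound for a first derivative in terms of bounds for the function and its second
derivative. -/
theorem abs_deriv_le_of_bounds {T M : ℝ} (hT : 0 < T) {y y1 y2 : ℝ → ℝ}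
    (h0 : ∀ t ∈ Icc 0 T, HasDerivWithinAt y (y1 t) (Icc 0 T) t)
    (h1 : ∀ t ∈ Icc 0 T, HasDerivWithinAt y1 (y2 t) (Icc 0 T) t)
    (hy : ∀ t ∈ Icc 0 T, |y t| ≤ M) (hy2 : ∀ t ∈ Icc 0 T, |y2 t| ≤ M) {t : ℝ}
    (ht : t ∈ Icc 0 T) : |y1 t| ≤ 3 * M / min 1 T := by
  set l := min 1 T with hl
  have hl0 : 0 < l := lt_min one_pos hT
  have hl1 : l ≤ 1 := min_le_left _ _
  have hlT : l ≤ T := min_le_right _ _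
  have hM : 0 ≤ M := (abs_nonneg _).trans (hy t ht)
  -- In a window of length l around `t`, the mean value theorem gives a point ξ with |y1 ξ| ≤ 2M/l;
  -- moving from ξ to `t` costs at most M ≤ M/l.
  obtain ⟨a, ha0, haT, hat, hta⟩ : ∃ a, 0 ≤ a ∧ a + l ≤ T ∧ a ≤ t ∧ t ≤ a + l := by
    rcases le_total t (T - l) with h | h
    · exact ⟨t, ht.1, by linarith, le_rfl, by linarith⟩
    · exact ⟨T - l, by linarith, by linarith, h, by linarith [ht.2]⟩
  have hsub : Icc a (a + l) ⊆ Icc 0 T := Icc_subset_Icc ha0 haT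
  obtain ⟨ξ, hξ, hξ'⟩ := exists_hasDerivAt_eq_slope y y1 (show a < a + l by linarith)
    (fun s hs => ((h0 s (hsub hs)).mono hsub).continuousWithinAt)
    (fun s hs => (h0 s (hsub (Ioo_subset_Icc_self hs))).hasDerivAt
      (Icc_mem_nhds (ha0.trans_lt hs.1) (hs.2.trans_le haT)))
  have hξI := hsub (Ioo_subset_Icc_self hξ)
  have e1 : |y1 ξ| ≤ 2 * M / l := by
    rw [hξ', add_sub_cancel_left, abs_div, abs_of_pos hl0]
    refine div_le_div_of_nonneg_right ?_ hl0.le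
    have := abs_sub (y (a + l)) (y a)
    linarith [hy a ⟨ha0, by linarith⟩, hy (a + l) ⟨by linarith, haT⟩]
  have e2 : |y1 t - y1 ξ| ≤ M * |t - ξ| :=
    abs_sub_le_of_deriv_bound h1 hy2 hξI ht
  have e3 : |t - ξ| ≤ 1 := by
    rw [abs_le]; constructor <;> linarith [hξ.1, hξ.2]
  have e4 : M ≤ M / l := by rw [le_div_iff₀ hl0]; nlinarith
  have e5 : |y1 t| ≤ |y1 ξ| + |y1 t - y1 ξ| := by
    have := abs_add_le (y1 ξ) (y1 t - y1 ξ)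
    rwa [add_sub_cancel] at this
  have e6 : 3 * M / l = 2 * M / l + M / l := by ring
  rw [e6]
  nlinarith

/-! ### Energy estimate and auxiliary inequalities -/

/-- The energy estimate for a perturbed dissipative equation. -/
theorem sq_le_integral_of_dissipative {T γ : ℝ} (hγ : 0 < γ) {e e' r : ℝ → ℝ}
    (he : ∀ t ∈ Icc 0 T, HasDerivWithinAt e (e' t) (Icc 0 T) t)
    (he0 : e 0 = 0) (hr : ContinuousOn r (Icc 0 T))
    (hdiss : ∀ t ∈ Icc 0 T, (e' t - r t) * e t ≤ -γ * e t ^ 2) {t : ℝ} (ht : t ∈ Icc 0 T) :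
    e t ^ 2 ≤ (∫ s in (0 : ℝ)..T, r s ^ 2) / (2 * γ) := by
  have hsub : Icc 0 t ⊆ Icc 0 T := Icc_subset_Icc_right ht.2
  have hcont : ContinuousOn e (Icc 0 T) := fun s hs => (he s hs).continuousWithinAt
  have hT : 0 ≤ T := ht.1.trans ht.2
  -- Young's inequality 2er ≤ 2γe² + r²/(2γ) absorbs the damping term exactly. Only the majorant
  -- r²/(2γ) has to be integrable, not e e'.
  have key := intervalIntegral.sub_le_integral_of_hasDeriv_right_of_le (a := 0) (b := t)
    (g := fun s => e s ^ 2) (g' := fun s => 2 * e s * e' s) (φ := fun s => r s ^ 2 / (2 * γ))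
    ht.1 ((hcont.mono hsub).pow 2)
    (fun s hs => by
      have hs' : s ∈ Icc 0 T := hsub (Ioo_subset_Icc_self hs)
      have := ((he s hs').hasDerivAt (Icc_mem_nhds hs.1 (hs.2.trans_le ht.2))).pow 2
      exact (this.congr_deriv (by simp)).hasDerivWithinAt)
    (((hr.mono hsub).pow 2).div_const _).integrableOn_Icc
    (fun s hs => by
      have hs' : s ∈ Icc 0 T := hsub (Ioo_subset_Icc_self hs)
      rw [le_div_iff₀ (by positivity)]
      have := hdiss s hs'
      nlinarith [sq_nonneg (2 * γ * e s - r s), mul_le_mul_of_nonneg_left this hγ.le])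
  simp only [he0] at key
  rw [intervalIntegral.integral_div] at key
  have hi : ∀ a b, a ∈ Icc 0 T → b ∈ Icc 0 T →
      IntervalIntegrable (fun s => r s ^ 2) MeasureTheory.volume a b := fun a b ha hb =>
    ((hr.pow 2).mono (uIcc_subset_Icc ha hb)).intervalIntegrable
  have hsplit := intervalIntegral.integral_add_adjacent_intervals
    (hi 0 t ⟨le_rfl, hT⟩ ht) (hi t T ht ⟨hT, le_rfl⟩)
  have hnn : 0 ≤ ∫ s in t..T, r s ^ 2 :=
    intervalIntegral.integral_nonneg ht.2 fun s _ => sq_nonneg _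
  have : (∫ s in (0 : ℝ)..t, r s ^ 2) / (2 * γ) ≤ (∫ s in (0 : ℝ)..T, r s ^ 2) / (2 * γ) :=
    div_le_div_of_nonneg_right (by linarith) (by positivity)
  linarith

/-- Removes the factor 1/min(1, T). For T ≥ 1, h² ≤ h^(3/2); for T ≤ 1, one factor h ≤ T cancels the
denominator and √T ≤ 1. -/
theorem sqrt_mul_sq_div_min_le {T h : ℝ} (hT : 0 < T) (h0 : 0 < h) (h1 : h ≤ 1) (hhT : h ≤ T) :
    Real.sqrt T * h ^ 2 / min 1 T ≤ h + Real.sqrt T * h ^ (3 / 2 : ℝ) := by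
  have hs := Real.sqrt_nonneg T
  have hss := Real.mul_self_sqrt hT.le
  have hp : 0 ≤ h ^ (3 / 2 : ℝ) := Real.rpow_nonneg h0.le _
  rcases le_total 1 T with hT1 | hT1
  · rw [min_eq_left hT1, div_one]
    have : h ^ 2 ≤ h ^ (3 / 2 : ℝ) := by
      rw [← Real.rpow_natCast]
      exact Real.rpow_le_rpow_of_exponent_ge h0 h1 (by norm_num)
    linarith [mul_le_mul_of_nonneg_left this hs]
  · rw [min_eq_right hT1, div_le_iff₀ hT]
    have hs1 : Real.sqrt T ≤ 1 := Real.sqrt_le_one.2 hT1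
    have : Real.sqrt T * h ^ 2 ≤ h * T := by nlinarith
    have := mul_nonneg (mul_nonneg hs hp) hT.le
    nlinarith

theorem differentiable_fst {F : ℝ → ℝ → ℝ} (hF : ContDiff ℝ 3 (fun p : ℝ × ℝ => F p.1 p.2))
    (t : ℝ) : Differentiable ℝ (fun y => F y t) :=
  (hF.differentiable (by norm_num)).comp (differentiable_id.prodMk (differentiable_const t))

theorem continuous_deriv_fst {F : ℝ → ℝ → ℝ}
    (hF : ContDiff ℝ 3 (fun p : ℝ × ℝ => F p.1 p.2)) :
    Continuous (fun p : ℝ × ℝ => deriv (fun z => F z p.2) p.1) := by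
  have h : ∀ p : ℝ × ℝ, deriv (fun z => F z p.2) p.1
      = fderiv ℝ (fun p : ℝ × ℝ => F p.1 p.2) p (1, 0) := by
    intro p
    have h1 := (hF.differentiable (by norm_num) p).hasFDerivAt
    have h2 : HasDerivAt (fun z : ℝ => (z, p.2)) (1, 0) p.1 :=
      (hasDerivAt_id p.1).prodMk (hasDerivAt_const p.1 p.2)
    exact (h1.comp_hasDerivAt p.1 h2).deriv
  simp_rw [h]
  exact (hF.continuous_fderiv (by norm_num)).clm_apply continuous_const

theorem continuous_deriv_snd {F : ℝ → ℝ → ℝ}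
    (hF : ContDiff ℝ 3 (fun p : ℝ × ℝ => F p.1 p.2)) :
    Continuous (fun p : ℝ × ℝ => deriv (fun u => F p.1 u) p.2) := by
  have h : ∀ p : ℝ × ℝ, deriv (fun u => F p.1 u) p.2
      = fderiv ℝ (fun p : ℝ × ℝ => F p.1 p.2) p (0, 1) := by
    intro p
    have h1 := (hF.differentiable (by norm_num) p).hasFDerivAt
    have h2 : HasDerivAt (fun u : ℝ => (p.1, u)) (0, 1) p.2 :=
      (hasDerivAt_const p.2 p.1).prodMk (hasDerivAt_id p.2)
    exact (h1.comp_hasDerivAt p.2 h2).deriv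
  simp_rw [h]
  exact (hF.continuous_fderiv (by norm_num)).clm_apply continuous_const

/-! ### Penalty minimizers in a dissipative tube -/

section Controlled

variable {F : ℝ → ℝ → ℝ} {T x₀ M γ δ : ℝ} {x : ℝ → ℝ}

/-- The mean value inequality for z ↦ F(z, t) + γz, multiplied by y - x(t); the tube is convex in
each time slice. -/
theorem Controlled.dissipative (hc : Controlled F T x M γ δ)
    (hF : ContDiff ℝ 3 (fun p : ℝ × ℝ => F p.1 p.2)) {t y : ℝ} (ht : t ∈ Icc 0 T)
    (hy : |y - x t| ≤ δ) : (F y t - F (x t) t) * (y - x t) ≤ -γ * (y - x t) ^ 2 := by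
  have hd := differentiable_fst hF t
  have hδ : 0 ≤ δ := (abs_nonneg _).trans hy
  have key := Convex.image_sub_le_mul_sub_of_deriv_le (convex_Icc (x t - δ) (x t + δ))
    hd.continuous.continuousOn hd.differentiableOn (C := -γ) (fun z hz => by
      have hz' := interior_subset hz
      exact hc.Fx_neg t ht z (abs_le.2 ⟨by linarith [hz'.1], by linarith [hz'.2]⟩))
  have hy' := abs_le.1 hy
  have hyI : y ∈ Icc (x t - δ) (x t + δ) := ⟨by linarith, by linarith⟩
  have hxI : x t ∈ Icc (x t - δ) (x t + δ) := ⟨by linarith, by linarith⟩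
  rcases le_total y (x t) with h | h
  · have := key y hyI (x t) hxI h
    nlinarith
  · have := key (x t) hxI y hyI h
    nlinarith

theorem Controlled.lipschitz (hc : Controlled F T x M γ δ)
    (hF : ContDiff ℝ 3 (fun p : ℝ × ℝ => F p.1 p.2)) {t y : ℝ} (ht : t ∈ Icc 0 T)
    (hy : |y - x t| ≤ δ) : |F y t - F (x t) t| ≤ M * |y - x t| := by
  have hδ : 0 ≤ δ := (abs_nonneg _).trans hy
  exact Convex.norm_image_sub_le_of_norm_deriv_le (f := fun z => F z t)
    (s := Metric.closedBall (x t) δ)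
    (fun z _ => differentiable_fst hF t z) (fun z hz => hc.Fx_le t ht z hz)
    (convex_closedBall _ _) (Metric.mem_closedBall_self hδ) hy

/-- The penalty controls the squared distance to the solution. -/
theorem sq_sub_le_penalty (hT : 0 < T) (hγ : 0 < γ)
    (hF : ContDiff ℝ 3 (fun p : ℝ × ℝ => F p.1 p.2)) (hx : IsSolution F T x₀ x)
    (hc : Controlled F T x M γ δ) {s : ℝ → ℝ} (hs : ContDiffOn ℝ 2 s (Icc 0 T)) (hs0 : s 0 = x₀)
    (hsx : ∀ t ∈ Icc 0 T, |s t - x t| ≤ δ) {t : ℝ} (ht : t ∈ Icc 0 T) :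
    (s t - x t) ^ 2 ≤ penalty F T s / (2 * γ) := by
  have h := sq_le_integral_of_dissipative (T := T) hγ (e := fun t => s t - x t)
    (e' := fun t => derivWithin s (Icc 0 T) t - F (x t) t)
    (r := fun t => derivWithin s (Icc 0 T) t - F (s t) t)
    (fun u hu => ((hs.differentiableOn (by norm_num) u hu).hasDerivWithinAt).sub (hx.2 u hu))
    (by simp [hs0, hx.1])
    ((hs.continuousOn_derivWithin (uniqueDiffOn_Icc hT) (by norm_num)).sub
      (hF.continuous.comp_continuousOn (hs.continuousOn.prodMk continuousOn_id)))
    (fun u hu => by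
      have := hc.dissipative hF hu (hsx u hu)
      simpa using this) ht
  simpa only [penalty, sq_abs] using h

/-- A smooth function close to the solution together with its derivative has small penalty. -/
theorem penalty_le (hT : 0 < T) (hM : 0 ≤ M)
    (hF : ContDiff ℝ 3 (fun p : ℝ × ℝ => F p.1 p.2)) (hc : Controlled F T x M γ δ)
    {w : ℝ → ℝ} (hw : ContDiff ℝ 2 w) {E : ℝ}
    (hwδ : ∀ t ∈ Icc 0 T, |w t - x t| ≤ δ) (hw0 : ∀ t ∈ Icc 0 T, |w t - x t| ≤ E)
    (hw1 : ∀ t ∈ Icc 0 T, |deriv w t - F (x t) t| ≤ E) :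
    penalty F T w ≤ ((1 + M) * E) ^ 2 * T := by
  have h := intervalIntegral.norm_integral_le_of_norm_le_const (a := 0) (b := T)
    (f := fun t => |derivWithin w (Icc 0 T) t - F (w t) t| ^ 2) (C := ((1 + M) * E) ^ 2)
    (fun t ht => by
      rw [uIoc_of_le hT.le] at ht
      have ht' := Ioc_subset_Icc_self ht
      rw [Real.norm_eq_abs, abs_of_nonneg (sq_nonneg _)]
      refine pow_le_pow_left₀ (abs_nonneg _) ?_ 2
      rw [(hw.differentiable (by norm_num) t).derivWithin (uniqueDiffOn_Icc hT t ht')]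
      have h1 := abs_le.1 (hw1 t ht')
      have h2 := abs_le.1 ((hc.lipschitz hF ht' (hwδ t ht')).trans
        (mul_le_mul_of_nonneg_left (hw0 t ht') hM))
      rw [abs_le]
      constructor <;> linarith [h1.1, h1.2, h2.1, h2.2])
  rw [sub_zero, abs_of_pos hT] at h
  exact (le_abs_self _).trans h

/-- The distance of a penalty minimizer to the solution, in terms of the mesh size. -/
theorem supNorm_sub_minimizer_le (hT : 0 < T) (hM : 0 < M) (hγ : 0 < γ)
    (hF : ContDiff ℝ 3 (fun p : ℝ × ℝ => F p.1 p.2)) (hx : IsSolution F T x₀ x)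
    (hc : Controlled F T x M γ δ) (τ : Knots T) (hτ : τ.mesh ≤ 1) {s : ℝ → ℝ}
    (hs : s ∈ minimizers F τ x₀ x δ) :
    supNorm T (fun t => x t - s t) ≤ 36 * M * τ.mesh +
      36 * M * (1 + M) / Real.sqrt (2 * γ) *
        (τ.mesh + Real.sqrt T * τ.mesh ^ (3 / 2 : ℝ)) := by
  have hx4 := hx.contDiffOn hT hF
  have hxc : ContinuousOn x (Icc 0 T) := hx4.continuousOn
  have hd := fun (k : ℕ) (hk : k < 4) (t : ℝ) (ht : t ∈ Icc 0 T) =>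
    hasDerivWithinAt_iteratedDerivWithin hT hx4 hk ht
  have hUD := uniqueDiffOn_Icc hT
  set h := τ.mesh with hh
  have hpos : 0 < h := τ.mesh_pos
  have hhT : h ≤ T := τ.mesh_le
  set l := min 1 T with hl
  have hl0 : 0 < l := lt_min one_pos hT
  have hhl : h ≤ l := le_min hτ hhT
  have hsc : ContDiffOn ℝ 2 s (Icc 0 T) := hs.1.1.1
  have hdist : ∀ t ∈ Icc 0 T, |s t - x t| ≤ supNorm T (fun t => s t - x t) := fun t ht =>
    abs_le_supNorm (f := fun t => s t - x t) (hsc.continuousOn.sub hxc) ht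
  have hsδ : ∀ t ∈ Icc 0 T, |s t - x t| ≤ δ := fun t ht => (hdist t ht).trans hs.1.2.2.le
  have hK : 0 ≤ 36 * M * (1 + M) / Real.sqrt (2 * γ) := by positivity
  have hrest : 0 ≤ h + Real.sqrt T * h ^ (3 / 2 : ℝ) := by positivity
  have hx1 : ∀ t ∈ Icc 0 T, iteratedDerivWithin 1 x (Icc 0 T) t = F (x t) t := by
    intro t ht
    rw [iteratedDerivWithin_one]
    exact (hx.2 t ht).derivWithin (hUD t ht)
  obtain ⟨w, hwτ, hw, hw0, hwx⟩ := exists_mem_cubicSplines_approx τ (B := 3 * M / l)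
    (by simpa only [iteratedDerivWithin_zero] using hd 0 (by norm_num)) (hd 1 (by norm_num)) (hd 2 (by norm_num))
    (fun t ht => abs_deriv_le_of_bounds hT (hd 2 (by norm_num)) (hd 3 (by norm_num))
      (hc.deriv_le 2 (by simp)) (hc.deriv_le 4 (by simp)) ht)
  rw [← hh] at hwx
  set E := 12 * (3 * M / l) * h ^ 2 with hE
  have hE0 : 0 ≤ E := by positivity
  have hEh : 12 * (3 * M / l) * h ^ 3 = E * h := by rw [hE]; ring
  rw [hEh] at hwx
  have hEl : E * h ≤ 36 * M * h := by
    have h1 : E * h = 36 * M * h * (h ^ 2 / l) := by rw [hE]; ring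
    have h2 : h ^ 2 / l ≤ 1 := by rw [div_le_one hl0]; nlinarith
    rw [h1]
    exact mul_le_of_le_one_right (by positivity) h2
  -- If the interpolant is certified to lie in the tube, it competes with `s`. Otherwise δ ≤ E h ≤
  -- 36Mh, and the admissibility of `s` already bounds the distance.
  by_cases hcase : E * h < δ
  · have hwE : ∀ t ∈ Icc 0 T, |w t - x t| ≤ E := fun t ht =>
      (hwx t ht).1.trans (mul_le_of_le_one_right hE0 hτ)
    have hwadm : w ∈ admissible τ x₀ x δ :=
      ⟨hwτ, hw0.trans hx.1, (supNorm_le hT fun t ht => (hwx t ht).1).trans_lt hcase⟩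
    have hpen : penalty F T s ≤ ((1 + M) * E) ^ 2 * T :=
      (hs.2 w hwadm).trans (penalty_le hT hM.le hF hc hw
        (fun t ht => (hwx t ht).1.trans hcase.le) hwE
        (fun t ht => by rw [← hx1 t ht]; exact (hwx t ht).2))
    refine (supNorm_le hT fun t ht => ?_).trans (le_add_of_nonneg_left (by positivity))
    have h1 : (s t - x t) ^ 2 ≤ ((1 + M) * E) ^ 2 * T / (2 * γ) :=
      (sq_sub_le_penalty hT hγ hF hx hc hsc hs.1.2.1 hsδ ht).trans
        (div_le_div_of_nonneg_right hpen (by positivity))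
    have h2 : ((1 + M) * E) ^ 2 * T / (2 * γ)
        = ((1 + M) * E * Real.sqrt T / Real.sqrt (2 * γ)) ^ 2 := by
      rw [div_pow, mul_pow _ (Real.sqrt T), Real.sq_sqrt hT.le, Real.sq_sqrt (by positivity)]
    rw [h2] at h1
    rw [abs_sub_comm]
    refine (abs_le_of_sq_le_sq h1 (by positivity)).trans ?_
    have h3 : (1 + M) * E * Real.sqrt T / Real.sqrt (2 * γ)
        = 36 * M * (1 + M) / Real.sqrt (2 * γ) * (Real.sqrt T * h ^ 2 / l) := by
      rw [hE]; ring
    rw [h3]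
    exact mul_le_mul_of_nonneg_left (sqrt_mul_sq_div_min_le hT hpos hτ hhT) hK
  · refine le_trans (supNorm_le hT fun t ht => ?_)
      ((not_lt.1 hcase).trans (hEl.trans (le_add_of_nonneg_right (mul_nonneg hK hrest))))
    rw [abs_sub_comm]
    exact hsδ t ht

/-- Since κ ≥ 1, the terms in `h` fit into β₂ = L + K and the term in √T h^(3/2) into β₄ = K. The
positive β₅ and β₆ terms give the strict inequality. -/
theorem lt_errorBound {K L κ h T D S : ℝ} (hK : 0 < K) (hL : 0 < L) (hκ : 1 ≤ κ) (hh : 0 < h)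
    (hT : 0 < T) (hD : 0 ≤ D) (hS : S ≤ L * h + K * (h + Real.sqrt T * h ^ (3 / 2 : ℝ))) :
    S < errorBound 1 (L + K) 1 K 1 1 κ h T D := by
  have hsT : 0 < Real.sqrt T := Real.sqrt_pos.2 hT
  have hκ0 : 0 < κ := one_pos.trans_le hκ
  have t1 : 0 ≤ 1 * κ * D * h ^ (1 / 2 : ℝ) := by positivity
  have t2 : (L + K) * h ≤ (L + K) * κ * h :=
    mul_le_mul_of_nonneg_right (le_mul_of_one_le_right (by positivity) hκ) hh.le
  have t3 : K * (Real.sqrt T * h ^ (3 / 2 : ℝ))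
      ≤ κ * (4 * Real.sqrt (6 * κ) + 1) * K * Real.sqrt T * h ^ (3 / 2 : ℝ) := by
    have h1 : 1 ≤ κ * (4 * Real.sqrt (6 * κ) + 1) := by
      nlinarith [Real.sqrt_nonneg (6 * κ)]
    have h2 : 0 ≤ K * (Real.sqrt T * h ^ (3 / 2 : ℝ)) := by positivity
    calc K * (Real.sqrt T * h ^ (3 / 2 : ℝ))
        ≤ κ * (4 * Real.sqrt (6 * κ) + 1) * (K * (Real.sqrt T * h ^ (3 / 2 : ℝ))) :=
          le_mul_of_one_le_left h2 h1
      _ = _ := by ring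
  have t4 : 0 < 1 * Real.sqrt T * h ^ 3 := by positivity
  have t5 : 0 < 1 * Real.sqrt T * h ^ (7 / 2 : ℝ) := by positivity
  unfold errorBound
  linarith

/-- Constants for the error bound that depend only on `M` and `γ`. -/
theorem exists_uniform_errorBound {M γ : ℝ} (δ : ℝ) (hM : 0 < M) (hγ : 0 < γ) :
    ∃ β₁ β₂ β₃ β₄ β₅ β₆ : ℝ,
      0 < β₁ ∧ 0 < β₂ ∧ 0 < β₃ ∧ 0 < β₄ ∧ 0 < β₅ ∧ 0 < β₆ ∧
      ∀ (F : ℝ → ℝ → ℝ) (T x₀ : ℝ) (x : ℝ → ℝ), 0 < T →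
        ContDiff ℝ 3 (fun p : ℝ × ℝ => F p.1 p.2) → IsSolution F T x₀ x →
        Controlled F T x M γ δ → ErrorBoundHolds F T x₀ x δ β₁ β₂ β₃ β₄ β₅ β₆ := by
  have hK : 0 < 36 * M * (1 + M) / Real.sqrt (2 * γ) := by positivity
  have hL : 0 < 36 * M := by positivity
  refine ⟨1, 36 * M + 36 * M * (1 + M) / Real.sqrt (2 * γ), 1,
    36 * M * (1 + M) / Real.sqrt (2 * γ), 1, 1, one_pos, add_pos hL hK, one_pos, hK, one_pos,
    one_pos, ?_⟩
  intro F T x₀ x hT hF hx hc τ hτ s hs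
  exact lt_errorBound hK hL τ.one_le_ratio τ.mesh_pos hT (Real.sqrt_nonneg _)
    (supNorm_sub_minimizer_le hT hM hγ hF hx hc τ hτ hs)

/-- Dissipativity along the solution gives uniform control in a tube around it. -/
theorem exists_controlled (hT : 0 < T) (hF : ContDiff ℝ 3 (fun p : ℝ × ℝ => F p.1 p.2))
    (hx : IsSolution F T x₀ x) (hneg : ∀ t ∈ Icc 0 T, deriv (fun y => F y t) (x t) < 0) :
    ∃ M γ δ : ℝ, 0 < M ∧ 0 < γ ∧ 0 < δ ∧ Controlled F T x M γ δ := by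
  have hx4 := hx.contDiffOn hT hF
  have hxc : ContinuousOn x (Icc 0 T) := hx4.continuousOn
  have hI : IsCompact (Icc (0 : ℝ) T) := isCompact_Icc
  have hP : IsCompact (Icc (0 : ℝ) T ×ˢ Icc (-1 : ℝ) 1) := hI.prod isCompact_Icc
  -- The coordinates (t, y - x(t)) straighten the unit tube to a compact rectangle.
  have hφ : ContinuousOn (fun q : ℝ × ℝ => (x q.1 + q.2, q.1)) (Icc (0 : ℝ) T ×ˢ Icc (-1 : ℝ) 1) :=
    ((hxc.comp continuousOn_fst fun q hq => hq.1).add continuousOn_snd).prodMk continuousOn_fst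
  have bound : ∀ G : ℝ × ℝ → ℝ, Continuous G → ∃ C, ∀ t ∈ Icc 0 T, ∀ y, |y - x t| ≤ 1 →
      |G (y, t)| ≤ C := by
    intro G hG
    obtain ⟨C, hC⟩ := hP.exists_bound_of_continuousOn (hG.comp_continuousOn hφ)
    refine ⟨C, fun t ht y hy => ?_⟩
    simpa using hC (t, y - x t) ⟨ht, abs_le.1 hy⟩
  have dbound : ∀ k : ℕ, k ≤ 4 → ∃ C, ∀ t ∈ Icc 0 T, |iteratedDerivWithin k x (Icc 0 T) t| ≤ C :=
    fun k hk => hI.exists_bound_of_continuousOn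
      (hx4.continuousOn_iteratedDerivWithin (by exact_mod_cast hk) (uniqueDiffOn_Icc hT))
  obtain ⟨C1, h1⟩ := dbound 1 (by norm_num)
  obtain ⟨C2, h2⟩ := dbound 2 (by norm_num)
  obtain ⟨C4, h4⟩ := dbound 4 le_rfl
  obtain ⟨B0, b0⟩ := bound _ hF.continuous
  obtain ⟨B1, b1⟩ := bound _ (continuous_deriv_fst hF)
  obtain ⟨B2, b2⟩ := bound _ (continuous_deriv_snd hF)
  have hFx := (continuous_deriv_fst hF).comp_continuousOn hφ
  obtain ⟨t₀, ht₀, hmax⟩ := hI.exists_isMaxOn ⟨0, le_rfl, hT.le⟩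
    ((continuous_deriv_fst hF).comp_continuousOn (hxc.prodMk continuousOn_id))
  set g := -deriv (fun y => F y t₀) (x t₀) with hg
  have hg0 : 0 < g := neg_pos.2 (hneg t₀ ht₀)
  -- Along x, F_x ≤ -g by compactness. By uniform continuity, moving off x by less than ε changes
  -- F_x by less than g/2, so γ = g/2 works on a thin tube.
  obtain ⟨ε, hε, hunif⟩ := Metric.uniformContinuousOn_iff.1
    (hP.uniformContinuousOn_of_continuous hFx) (g / 2) (by positivity)
  have le_sum : ∀ k ∈ ({|C1|, |C2|, |C4|, |B0|, |B1|, |B2|} : Set ℝ),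
      k ≤ 1 + |C1| + |C2| + |C4| + |B0| + |B1| + |B2| := by
    intro k hk
    simp only [mem_insert_iff, mem_singleton_iff] at hk
    rcases hk with rfl | rfl | rfl | rfl | rfl | rfl <;>
      linarith [abs_nonneg C1, abs_nonneg C2, abs_nonneg C4, abs_nonneg B0, abs_nonneg B1,
        abs_nonneg B2]
  have hδ1 : min 1 (ε / 2) ≤ 1 := min_le_left _ _
  refine ⟨1 + |C1| + |C2| + |C4| + |B0| + |B1| + |B2|, g / 2, min 1 (ε / 2), by positivity,
    by positivity, by positivity, ?_, ?_, ?_, ?_, ?_⟩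
  · intro k hk t ht
    simp only [mem_insert_iff, mem_singleton_iff] at hk
    rcases hk with rfl | rfl | rfl
    · exact ((h1 t ht).trans (le_abs_self _)).trans (le_sum _ (by simp))
    · exact ((h2 t ht).trans (le_abs_self _)).trans (le_sum _ (by simp))
    · exact ((h4 t ht).trans (le_abs_self _)).trans (le_sum _ (by simp))
  · exact fun t ht y hy =>
      ((b0 t ht y (hy.trans hδ1)).trans (le_abs_self _)).trans (le_sum _ (by simp))
  · exact fun t ht y hy =>
      ((b1 t ht y (hy.trans hδ1)).trans (le_abs_self _)).trans (le_sum _ (by simp))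
  · exact fun t ht y hy =>
      ((b2 t ht y (hy.trans hδ1)).trans (le_abs_self _)).trans (le_sum _ (by simp))
  · intro t ht y hy
    have hlt : dist (t, y - x t) (t, (0 : ℝ)) < ε := by
      rw [Prod.dist_eq, dist_self, Real.dist_eq, sub_zero, max_eq_right (abs_nonneg _)]
      linarith [hy.trans (min_le_right _ _)]
    have h := hunif (t, y - x t) ⟨ht, abs_le.1 (hy.trans hδ1)⟩ (t, 0) ⟨ht, by simp⟩ hlt
    simp only [Function.comp_apply, add_sub_cancel, add_zero, Real.dist_eq] at h
    have h' := (abs_lt.1 h).2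
    have hm : deriv (fun y => F y t) (x t) ≤ -g := by
      rw [hg, neg_neg]
      exact hmax ht
    linarith

end Controlled

end SplineODE

theorem theorem4p1 :
    -- the error bound, with a radius and constants that depend only on `x` and `F`
    (∀ (F : ℝ → ℝ → ℝ) (T x₀ : ℝ) (x : ℝ → ℝ), 0 < T →
      ContDiff ℝ 3 (fun p : ℝ × ℝ => F p.1 p.2) →
      SplineODE.IsSolution F T x₀ x →
      (∀ t ∈ Set.Icc 0 T, deriv (fun y => F y t) (x t) < 0) →
      ∃ δ₂ : ℝ, 0 < δ₂ ∧ ∃ β₁ β₂ β₃ β₄ β₅ β₆ : ℝ,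
        0 < β₁ ∧ 0 < β₂ ∧ 0 < β₃ ∧ 0 < β₄ ∧ 0 < β₅ ∧ 0 < β₆ ∧
        SplineODE.ErrorBoundHolds F T x₀ x δ₂ β₁ β₂ β₃ β₄ β₅ β₆) ∧
    -- the constants depend on `x` and `F` only through bounds; they do not depend on `T` otherwise
    (∀ M γ δ₂ : ℝ, 0 < M → 0 < γ → 0 < δ₂ →
      ∃ β₁ β₂ β₃ β₄ β₅ β₆ : ℝ,
        0 < β₁ ∧ 0 < β₂ ∧ 0 < β₃ ∧ 0 < β₄ ∧ 0 < β₅ ∧ 0 < β₆ ∧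
        ∀ (F : ℝ → ℝ → ℝ) (T x₀ : ℝ) (x : ℝ → ℝ), 0 < T →
          ContDiff ℝ 3 (fun p : ℝ × ℝ => F p.1 p.2) →
          SplineODE.IsSolution F T x₀ x →
          SplineODE.Controlled F T x M γ δ₂ →
          SplineODE.ErrorBoundHolds F T x₀ x δ₂ β₁ β₂ β₃ β₄ β₅ β₆) := by
  refine ⟨fun F T x₀ x hT hF hx hneg => ?_, fun M γ δ₂ hM hγ _ =>
    SplineODE.exists_uniform_errorBound δ₂ hM hγ⟩
  obtain ⟨M, γ, δ, hM, hγ, hδ, hc⟩ := SplineODE.exists_controlled hT hF hx hneg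
  obtain ⟨β₁, β₂, β₃, β₄, β₅, β₆, h₁, h₂, h₃, h₄, h₅, h₆, h⟩ :=
    SplineODE.exists_uniform_errorBound δ hM hγ
  exact ⟨δ, hδ, β₁, β₂, β₃, β₄, β₅, β₆, h₁, h₂, h₃, h₄, h₅, h₆, h F T x₀ x hT hF hx hc⟩
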